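/- Let $\mathcal A\subset\mathbb R^d$ be a finite set spanning $\mathbb R^d$ with $\|x\|\le 1$ for all $x\in\mathcal A$, and let $\theta\in\mathbb R^d$. A learner interacts with the linear bandit $(\mathcal A,\theta)$ for $n$ rounds: in round $t\in\{1,\dots,n\}$ it chooses $A_t\in\mathcal A$ based on $A_1,Y_1,\dots,A_{t-1},Y_{t-1}$ (and possibly on its own randomisation) and then observes $Y_t=\langle A_t,\theta\rangle+\eta_t$, where $\eta_t\sim\mathcal N(0,1)$ is independent of everything on which the choice of $A_t$ was based. Put $G_t=\sum_{s=1}^t A_sA_s^\top$, $\hat\theta(t)=G_t^{-1}\sum_{s=1}^t A_sY_s$, $\hat\mu_x(t)=\langle x,\hat\theta(t)\rangle$, $\mu_x=\langle x,\theta\rangle$ and $\|x\|_{M}^2=x^\top Mx$. There is a universal constant $c>0$ such that, with $$f_{n,\delta}=2\Bigl(1+\frac1{\log n}\Bigr)\log(1/\delta)+c\,d\log(d\log n),$$ the following holds. For all $d$ and $\mathcal A$ as above and all sufficiently large $n$ (how large depends only on $d$ and $\mathcal A$), for all $\delta\in[1/n,1)$, all $\theta$, all learners, and all $t_0\in\mathbb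 N$ such that $G_{t_0}$ is almost surely non-singular, $$\mathbb P\Bigl(\exists\, t\in\{t_0,\dots,n\},\ \exists\, x\in\mathcal A\setminus\{0\}:\ |\hat\mu_x(t)-\mu_x|\ge\sqrt{\|x\|_{G_t^{-1}}^2 f_{n,\delta}}\Bigr)\le\delta .$$ Moreover, for every $d$, $f_{n,1/n}\sim 2\log n$ as $n\to\infty$. -/

import Mathlib

open scoped Matrix

noncomputable section

namespace LinearBandit

open MeasureTheory ProbabilityTheory

/-- The Gram matrix `G_t = ∑_{s=1}^t A_s A_sᵀ` of the actions `A_1, …, A_t`. -/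
def gram {d : ℕ} (A : ℕ → EuclideanSpace ℝ (Fin d)) (t : ℕ) : Matrix (Fin d) (Fin d) ℝ :=
  ∑ s ∈ Finset.Icc 1 t, Matrix.vecMulVec (A s).ofLp (A s).ofLp

/-- The least-squares estimate `G_t⁻¹ ∑_{s=1}^t A_s Y_s` of the parameter. -/
def lsEstimate {d : ℕ} (A : ℕ → EuclideanSpace ℝ (Fin d)) (Y : ℕ → ℝ) (t : ℕ) :
    EuclideanSpace ℝ (Fin d) :=
  WithLp.toLp 2 ((gram A t)⁻¹ *ᵥ (∑ s ∈ Finset.Icc 1 t, Y s • A s).ofLp)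

/-- The squared weighted norm `‖x‖_M² = xᵀ M x`. -/
def sqNorm {d : ℕ} (M : Matrix (Fin d) (Fin d) ℝ) (x : EuclideanSpace ℝ (Fin d)) : ℝ :=
  x.ofLp ⬝ᵥ (M *ᵥ x.ofLp)

/-- The noise `η_t = Y_t - ⟨A_t, θ⟩`. -/
def noise {Ω : Type*} {d : ℕ} (θ : EuclideanSpace ℝ (Fin d))
    (A : ℕ → Ω → EuclideanSpace ℝ (Fin d)) (Y : ℕ → Ω → ℝ) (t : ℕ) (ω : Ω) : ℝ :=
  Y t ω - inner ℝ (A t ω) θ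

/-- `(A_t, Y_t)`, `1 ≤ t ≤ n`, is the interaction over `n` rounds of a learner with the linear
bandit with arms `𝒜`, parameter `θ` and standard Gaussian noise. The σ-algebra `ℱ t` is the
information on which the choice of `A_{t+1}` is based; it contains the history
`A_1, Y_1, …, A_t, Y_t` and possibly the learner's own randomisation. -/
structure IsInteraction {Ω : Type*} [mΩ : MeasurableSpace Ω] {d : ℕ}
    (P : Measure Ω) (ℱ : Filtration ℕ mΩ) (n : ℕ)
    (𝒜 : Finset (EuclideanSpace ℝ (Fin d))) (θ : EuclideanSpace ℝ (Fin d))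
    (A : ℕ → Ω → EuclideanSpace ℝ (Fin d)) (Y : ℕ → Ω → ℝ) : Prop where
  action_mem : ∀ t < n, ∀ ω, A (t + 1) ω ∈ 𝒜
  action_measurable : ∀ t < n, Measurable[ℱ t] (A (t + 1))
  reward_measurable : ∀ t < n, Measurable[ℱ (t + 1)] (Y (t + 1))
  noise_law : ∀ t < n, HasLaw (noise θ A Y (t + 1)) (gaussianReal 0 1) P
  noise_indep : ∀ t < n,
    Indep (MeasurableSpace.comap (noise θ A Y (t + 1)) inferInstance) (ℱ t) P

/-- `f_{n,δ} = 2 (1 + 1 / log n) log (1 / δ) + c d log (d log n)`. -/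
def width (c : ℝ) (d n : ℕ) (δ : ℝ) : ℝ :=
  2 * (1 + 1 / Real.log n) * Real.log (1 / δ) + c * d * Real.log (d * Real.log n)

end LinearBandit

end

/-! Write `S_t` for the noise-weighted sum of the actions. The estimation error in direction `x` is
`xᵀ G_t⁻¹ S_t`, so by Cauchy–Schwarz it suffices to keep `S_tᵀ G_t⁻¹ S_t` below the width for all
`t` at once (`le_dotProduct_inv_of_sqrt_le`). For a fixed positive definite `H'`, averaging the
exponential martingales `exp (⟪u, S_t⟫ - uᵀ G_t u / 2)` over `u ∼ 𝒩(0, H'⁻¹)` yields a martingale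
proportional to `mixture (H' + G_t) S_t`. Ville's inequality then bounds `S_tᵀ (H' + G_t)⁻¹ S_t` by
`2 log (1/δ) + log (det (H' + G_t) / det H')`, uniformly in time.

With one fixed `H'` the determinant term can be of order `d log n`, which is too large. Instead `H'`
is adapted to `G_t` through a union bound over few candidates. A basis chosen greedily among the
most played arms, with play counts rounded down to powers of two, has a Gram matrix `H` with `H ≤
G_t ≤ C H`, where `C` depends on `𝒜` only (`exists_dyadicGram_le_gram`). There are at most `(#𝒜 *
(Nat.log 2 n + 1)) ^ d` such `H`.

Take `H' = H / L` with `L = log n`. Passing from `(H' + G_t)⁻¹` to `G_t⁻¹` costs a factor `1 + 1/L`,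
and the determinant ratio is at most `(1 + C L) ^ d` (`dotProduct_inv_lt_of_mixture_lt`). For large
`n` both `#𝒜` and `C` are below `log n`, so the determinant and the union bound each cost `O(d log
log n)`. -/

namespace LinearBandit

open MeasureTheory ProbabilityTheory

/-! ### Quadratic forms and determinants of positive definite matrices. -/

section LinearAlgebra

variable {d : ℕ}

theorem dotProduct_mulVec_comm_of_posDef {V : Matrix (Fin d) (Fin d) ℝ} (hV : V.PosDef)
    (u v : Fin d → ℝ) : u ⬝ᵥ (V *ᵥ v) = v ⬝ᵥ (V *ᵥ u) := by
  have hT : Vᵀ = V := by simpa using hV.isHermitian.eq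
  rw [Matrix.dotProduct_mulVec, ← Matrix.mulVec_transpose, hT, dotProduct_comm]

theorem dotProduct_mulVec_nonneg_of_posDef {V : Matrix (Fin d) (Fin d) ℝ} (hV : V.PosDef)
    (u : Fin d → ℝ) : 0 ≤ u ⬝ᵥ (V *ᵥ u) := by
  simpa using hV.posSemidef.dotProduct_mulVec_nonneg u

theorem mulVec_inv_mulVec {V : Matrix (Fin d) (Fin d) ℝ} (hV : V.PosDef) (u : Fin d → ℝ) :
    V *ᵥ (V⁻¹ *ᵥ u) = u := by
  rw [Matrix.mulVec_mulVec, Matrix.mul_nonsing_inv _ ((Matrix.isUnit_iff_isUnit_det _).1 hV.isUnit),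
    Matrix.one_mulVec]

theorem inv_mulVec_mulVec {V : Matrix (Fin d) (Fin d) ℝ} (hV : IsUnit V) (u : Fin d → ℝ) :
    V⁻¹ *ᵥ (V *ᵥ u) = u := by
  rw [Matrix.mulVec_mulVec, Matrix.nonsing_inv_mul _ ((Matrix.isUnit_iff_isUnit_det _).1 hV),
    Matrix.one_mulVec]

theorem posSemidef_vecMulVec_self (a : Fin d → ℝ) : (Matrix.vecMulVec a a).PosSemidef := by
  simpa using Matrix.posSemidef_vecMulVec_self_star a

theorem dotProduct_vecMulVec_mulVec (a u : Fin d → ℝ) :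
    u ⬝ᵥ (Matrix.vecMulVec a a *ᵥ u) = (u ⬝ᵥ a) ^ 2 := by
  rw [Matrix.vecMulVec_mulVec, dotProduct_comm a u]
  simp [pow_two]

theorem det_add_vecMulVec {V : Matrix (Fin d) (Fin d) ℝ} (hV : V.PosDef) (a : Fin d → ℝ) :
    (V + Matrix.vecMulVec a a).det = V.det * (1 + a ⬝ᵥ (V⁻¹ *ᵥ a)) := by
  rw [Matrix.vecMulVec_eq Unit, Matrix.det_add_replicateCol_mul_replicateRow hV.det_pos.ne'.isUnit]
  congr 1
  rw [Matrix.det_unique]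
  simp [Matrix.mul_assoc, Matrix.mul_apply, dotProduct, Matrix.mulVec]

/-- Sherman–Morrison, arranged as a completed square in `x`: this exhibits the Gaussian density of
mean `m` and variance `1 + q` used in `lintegral_mixture_add`. -/
theorem dotProduct_inv_add_vecMulVec {V : Matrix (Fin d) (Fin d) ℝ} (hV : V.PosDef)
    (S a : Fin d → ℝ) (x : ℝ) :
    (S + x • a) ⬝ᵥ ((V + Matrix.vecMulVec a a)⁻¹ *ᵥ (S + x • a)) =
      S ⬝ᵥ (V⁻¹ *ᵥ S) + x ^ 2
        - (x - a ⬝ᵥ (V⁻¹ *ᵥ S)) ^ 2 / (1 + a ⬝ᵥ (V⁻¹ *ᵥ a)) := by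
  have hV' : (V + Matrix.vecMulVec a a).PosDef := hV.add_posSemidef (posSemidef_vecMulVec_self a)
  have hq : 0 ≤ a ⬝ᵥ (V⁻¹ *ᵥ a) := dotProduct_mulVec_nonneg_of_posDef hV.inv a
  have hm : S ⬝ᵥ (V⁻¹ *ᵥ a) = a ⬝ᵥ (V⁻¹ *ᵥ S) := dotProduct_mulVec_comm_of_posDef hV.inv S a
  set m := a ⬝ᵥ (V⁻¹ *ᵥ S) with hmdef
  set q := a ⬝ᵥ (V⁻¹ *ᵥ a) with hqdef
  have h1 : (1 + q) ≠ 0 := by positivity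
  have key : (V + Matrix.vecMulVec a a)⁻¹ *ᵥ (S + x • a) =
      V⁻¹ *ᵥ S + ((x - m) / (1 + q)) • (V⁻¹ *ᵥ a) := by
    rw [← inv_mulVec_mulVec hV'.isUnit (V⁻¹ *ᵥ S + ((x - m) / (1 + q)) • (V⁻¹ *ᵥ a))]
    congr 1
    rw [Matrix.add_mulVec, Matrix.mulVec_add, Matrix.mulVec_smul, mulVec_inv_mulVec hV,
      mulVec_inv_mulVec hV, Matrix.vecMulVec_mulVec, dotProduct_add, dotProduct_smul, ← hmdef,
      ← hqdef]
    ext i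
    simp
    field_simp
    ring
  rw [key]
  simp only [add_dotProduct, dotProduct_add, dotProduct_smul, smul_dotProduct, hm, ← hmdef,
    ← hqdef, smul_eq_mul]
  field_simp
  ring

/-- Antitonicity of the inverse: if `V ≤ c G` then `G⁻¹ ≤ c V⁻¹`. -/
theorem dotProduct_inv_le_of_le {V G : Matrix (Fin d) (Fin d) ℝ} (hV : V.PosDef) (hG : G.PosDef)
    {c : ℝ} (hc : 0 < c) (h : ∀ u, u ⬝ᵥ (V *ᵥ u) ≤ c * (u ⬝ᵥ (G *ᵥ u))) (S : Fin d → ℝ) :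
    S ⬝ᵥ (G⁻¹ *ᵥ S) ≤ c * (S ⬝ᵥ (V⁻¹ *ᵥ S)) := by
  set u := G⁻¹ *ᵥ S with hu
  set w := V⁻¹ *ᵥ S with hw
  -- Expanded, this reads `uᵀVu - 2c u·S + c² w·S ≥ 0`; inserting `uᵀVu ≤ c u·S` leaves `c (c w·S -
  -- u·S) ≥ 0`.
  have h1 := dotProduct_mulVec_nonneg_of_posDef hV (u - c • w)
  have hGu : G *ᵥ u = S := mulVec_inv_mulVec hG S
  have hVw : V *ᵥ w = S := mulVec_inv_mulVec hV S
  have h2 := h u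
  have h3 : w ⬝ᵥ (V *ᵥ u) = u ⬝ᵥ S := by
    rw [dotProduct_mulVec_comm_of_posDef hV, hVw]
  rw [hGu] at h2
  simp only [Matrix.mulVec_sub, Matrix.mulVec_smul, sub_dotProduct, dotProduct_sub,
    smul_dotProduct, dotProduct_smul, smul_eq_mul, hVw, h3] at h1
  rw [dotProduct_comm S u, dotProduct_comm S w]
  have : 0 ≤ c * (c * (w ⬝ᵥ S) - u ⬝ᵥ S) := by nlinarith
  have := nonneg_of_mul_nonneg_right this hc
  linarith

/-- Cauchy–Schwarz for the form `G⁻¹`, from the discriminant of `t ↦ ‖x + t S‖²`. -/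
theorem sq_dotProduct_inv_le {G : Matrix (Fin d) (Fin d) ℝ} (hG : G.PosDef) (x S : Fin d → ℝ) :
    (x ⬝ᵥ (G⁻¹ *ᵥ S)) ^ 2 ≤ (x ⬝ᵥ (G⁻¹ *ᵥ x)) * (S ⬝ᵥ (G⁻¹ *ᵥ S)) := by
  have h (t : ℝ) : 0 ≤ (S ⬝ᵥ (G⁻¹ *ᵥ S)) * (t * t) + (2 * (x ⬝ᵥ (G⁻¹ *ᵥ S))) * t +
      x ⬝ᵥ (G⁻¹ *ᵥ x) := by
    have h1 := dotProduct_mulVec_nonneg_of_posDef hG.inv (x + t • S)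
    simp only [Matrix.mulVec_add, Matrix.mulVec_smul, add_dotProduct, dotProduct_add,
      smul_dotProduct, dotProduct_smul, smul_eq_mul,
      dotProduct_mulVec_comm_of_posDef hG.inv S x] at h1
    linarith
  have := discrim_le_zero h
  rw [discrim] at this
  linarith

theorem det_le_pow_of_dotProduct_mulVec_le {N : Matrix (Fin d) (Fin d) ℝ} (hN : N.PosSemidef)
    {c : ℝ} (h : ∀ u, u ⬝ᵥ (N *ᵥ u) ≤ c * (u ⬝ᵥ u)) : N.det ≤ c ^ d := by
  rw [hN.isHermitian.det_eq_prod_eigenvalues]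
  calc ∏ i, ((hN.isHermitian.eigenvalues i : ℝ)) ≤ ∏ i : Fin d, c := by
        refine Finset.prod_le_prod (fun i _ => hN.eigenvalues_nonneg i) fun i _ => ?_
        have h1 := h (hN.isHermitian.eigenvectorBasis i).ofLp
        have h2 := hN.isHermitian.eigenvalues_eq i
        have h3 : (hN.isHermitian.eigenvectorBasis i).ofLp ⬝ᵥ
            (hN.isHermitian.eigenvectorBasis i).ofLp = 1 := by
          have := real_inner_self_eq_norm_sq (hN.isHermitian.eigenvectorBasis i)
          rw [hN.isHermitian.eigenvectorBasis.orthonormal.1 i,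
            EuclideanSpace.inner_eq_star_dotProduct] at this
          simpa using this
        rw [h3] at h1
        simp at h2
        simp
        linarith
    _ = c ^ d := by simp

/-- Factoring `H = Bᵀ B` and conjugating `V` by `B⁻¹` reduces to `H = 1`, where all eigenvalues are
at most `c`. -/
theorem det_le_pow_mul_det {V H : Matrix (Fin d) (Fin d) ℝ} (hV : V.PosDef) (hH : H.PosDef)
    {c : ℝ} (h : ∀ u, u ⬝ᵥ (V *ᵥ u) ≤ c * (u ⬝ᵥ (H *ᵥ u))) : V.det ≤ c ^ d * H.det := by
  obtain ⟨B, hB⟩ : ∃ B : Matrix (Fin d) (Fin d) ℝ, H = Bᵀ * B := by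
    open scoped MatrixOrder in
    obtain ⟨B, hB⟩ := CStarAlgebra.nonneg_iff_eq_star_mul_self.1 hH.posSemidef.nonneg
    exact ⟨B, by simpa [Matrix.star_eq_conjTranspose] using hB⟩
  have hdet : H.det = B.det ^ 2 := by rw [hB, Matrix.det_mul, Matrix.det_transpose, pow_two]
  have hB0 : IsUnit B.det := by
    refine IsUnit.mk0 _ fun h0 => hH.det_pos.ne' ?_
    rw [hdet, h0]; simp
  set N : Matrix (Fin d) (Fin d) ℝ := (B⁻¹)ᵀ * V * B⁻¹ with hN
  have hNp : N.PosSemidef := by simpa using hV.posSemidef.conjTranspose_mul_mul_same B⁻¹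
  have hNV : V.det = B.det ^ 2 * N.det := by
    rw [hN, Matrix.det_mul, Matrix.det_mul, Matrix.det_transpose, Matrix.det_nonsing_inv,
      Ring.inverse_eq_inv]
    have := hB0.ne_zero
    field_simp
  have hNc : N.det ≤ c ^ d := by
    refine det_le_pow_of_dotProduct_mulVec_le hNp fun u => ?_
    have h1 := h (B⁻¹ *ᵥ u)
    have h2 : (B⁻¹ *ᵥ u) ⬝ᵥ (H *ᵥ (B⁻¹ *ᵥ u)) = u ⬝ᵥ u := by
      rw [hB, ← Matrix.mulVec_mulVec, Matrix.mulVec_mulVec _ B, Matrix.mul_nonsing_inv _ hB0,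
        Matrix.one_mulVec, Matrix.dotProduct_mulVec, Matrix.vecMul_transpose, Matrix.mulVec_mulVec,
        Matrix.mul_nonsing_inv _ hB0, Matrix.one_mulVec]
    have h3 : u ⬝ᵥ (N *ᵥ u) = (B⁻¹ *ᵥ u) ⬝ᵥ (V *ᵥ (B⁻¹ *ᵥ u)) := by
      rw [hN, ← Matrix.mulVec_mulVec, ← Matrix.mulVec_mulVec, Matrix.dotProduct_mulVec,
        Matrix.vecMul_transpose]
    rw [h3]
    linarith [h2 ▸ h1]
  rw [hNV, hdet, mul_comm]
  exact mul_le_mul_of_nonneg_right hNc (sq_nonneg _)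

end LinearAlgebra

/-! ### Maximal inequality for nonnegative supermartingales. -/

section Ville

variable {Ω : Type*} [mΩ : MeasurableSpace Ω]

/-- **Ville's inequality** on a finite horizon. -/
theorem mul_measure_exists_le_lintegral {P : Measure Ω} {ℱ : Filtration ℕ mΩ} {n : ℕ}
    {M : ℕ → Ω → ENNReal} (hM : ∀ k ≤ n, Measurable[ℱ k] (M k))
    (hstep : ∀ k < n, ∀ F, MeasurableSet[ℱ k] F →
      ∫⁻ ω in F, M (k + 1) ω ∂P ≤ ∫⁻ ω in F, M k ω ∂P) (c : ENNReal) :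
    c * P {ω | ∃ t ≤ n, c ≤ M t ω} ≤ ∫⁻ ω, M 0 ω ∂P := by
  let E : ℕ → Set Ω := fun k => {ω | ∃ t ≤ k, c ≤ M t ω}
  have hE (k : ℕ) (hk : k ≤ n) : MeasurableSet[ℱ k] (E k) := by
    have : E k = ⋃ t ∈ Finset.range (k + 1), {ω | c ≤ M t ω} := by
      ext ω; simp [E]
    rw [this]
    refine Finset.measurableSet_biUnion _ fun t ht => ?_
    have ht' : t ≤ k := by simpa [Nat.lt_succ_iff] using ht
    exact ℱ.mono ht' _ (measurableSet_le measurable_const (hM t (ht'.trans hk)))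
  have key (F : Set Ω) (k : ℕ) (hk : k ≤ n) :
      c * P (F ∩ {ω | c ≤ M k ω}) + ∫⁻ ω in F ∩ {ω | c ≤ M k ω}ᶜ, M k ω ∂P
        ≤ ∫⁻ ω in F, M k ω ∂P := by
    have hms : MeasurableSet {ω | c ≤ M k ω} :=
      ℱ.le k _ (measurableSet_le measurable_const (hM k hk))
    rw [← lintegral_inter_add_sdiff (M k) F hms]
    refine add_le_add ?_ (by rw [Set.sdiff_eq])
    rw [← setLIntegral_const]
    refine setLIntegral_mono (((hM k hk).mono (ℱ.le k) le_rfl)) ?_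
    exact fun ω hω => hω.2
  -- The left side dominates what Markov's inequality needs and is nonincreasing in `k`: mass is
  -- charged `c` at the first crossing and follows `M` until then.
  have main (k : ℕ) (hk : k ≤ n) :
      c * P (E k) + ∫⁻ ω in (E k)ᶜ, M k ω ∂P ≤ ∫⁻ ω, M 0 ω ∂P := by
    induction k with
    | zero =>
      have := key Set.univ 0 hk
      simpa [E, Set.compl_def] using this
    | succ k ih =>
      have hk' : k < n := hk
      have hEs : E (k + 1) = E k ∪ ((E k)ᶜ ∩ {ω | c ≤ M (k + 1) ω}) := by
        ext ω
        simp only [E, Set.mem_ofPred_eq, Set.mem_union, Set.mem_inter_iff, Set.mem_compl_iff]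
        constructor
        · rintro ⟨t, ht, h⟩
          by_cases h' : ∃ t ≤ k, c ≤ M t ω
          · exact Or.inl h'
          · refine Or.inr ⟨h', ?_⟩
            rcases Nat.le_succ_iff.1 ht with h1 | rfl
            · exact absurd ⟨t, h1, h⟩ h'
            · exact h
        · rintro (⟨t, ht, h⟩ | ⟨-, h⟩)
          · exact ⟨t, by omega, h⟩
          · exact ⟨k + 1, le_rfl, h⟩
      have hEc : (E (k + 1))ᶜ = (E k)ᶜ ∩ {ω | c ≤ M (k + 1) ω}ᶜ := by
        rw [hEs]; ext ω; simp; tauto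
      rw [hEc]
      calc c * P (E (k + 1)) + ∫⁻ ω in (E k)ᶜ ∩ {ω | c ≤ M (k + 1) ω}ᶜ, M (k + 1) ω ∂P
          ≤ c * P (E k) + (c * P ((E k)ᶜ ∩ {ω | c ≤ M (k + 1) ω})
              + ∫⁻ ω in (E k)ᶜ ∩ {ω | c ≤ M (k + 1) ω}ᶜ, M (k + 1) ω ∂P) := by
            rw [← add_assoc, ← mul_add, hEs]
            gcongr
            exact measure_union_le _ _
        _ ≤ c * P (E k) + ∫⁻ ω in (E k)ᶜ, M (k + 1) ω ∂P := by
            gcongr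
            exact key _ _ hk
        _ ≤ c * P (E k) + ∫⁻ ω in (E k)ᶜ, M k ω ∂P := by
            exact add_le_add le_rfl (hstep k hk' _ (hE k hk'.le).compl)
        _ ≤ _ := ih hk'.le
  exact (le_add_right le_rfl).trans (main n le_rfl)

end Ville

/-- Freezing: by independence the joint law is a product, so Tonelli integrates the noise out with
the past held fixed. -/
theorem lintegral_prodMk_of_indep {Ω β : Type*} {m mΩ : MeasurableSpace Ω}
    [MeasurableSpace β] {P : Measure Ω} [IsProbabilityMeasure P] (hm : m ≤ mΩ) {X : Ω → β}
    (hX : Measurable[m] X) {η : Ω → ℝ} {γ : Measure ℝ} [SFinite γ] (hη : HasLaw η γ P)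
    (hi : Indep (MeasurableSpace.comap η inferInstance) m P)
    {g : β × ℝ → ENNReal} (hg : Measurable g) :
    ∫⁻ ω, g (X ω, η ω) ∂P = ∫⁻ ω, ∫⁻ y, g (X ω, y) ∂γ ∂P := by
  have hX' : Measurable X := hX.mono hm le_rfl
  have hind : IndepFun X η P := by
    rw [IndepFun_iff_Indep]
    exact indep_of_indep_of_le_left hi.symm hX.comap_le
  have hmap := (indepFun_iff_map_prod_eq_prod_map_map hX'.aemeasurable hη.aemeasurable).1 hind
  rw [hη.map_eq] at hmap
  rw [← lintegral_map' (f := g) (g := fun ω => (X ω, η ω)) hg.aemeasurable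
    (hX'.aemeasurable.prodMk hη.aemeasurable), hmap, lintegral_prod _ hg.aemeasurable,
    lintegral_map hg.lintegral_prod_right' hX']

/-! ### The Gaussian mixture martingale. -/

section Mixture

variable {d : ℕ}

/-- Up to a factor independent of `V` and `S`, the integral of `exp (⟪u, S⟫ - uᵀ G u / 2)` over
`u ∼ 𝒩(0, H⁻¹)`, where `V = H + G`. -/
noncomputable def mixture (V : Matrix (Fin d) (Fin d) ℝ) (S : Fin d → ℝ) : ENNReal :=
  ENNReal.ofReal ((√V.det)⁻¹ * Real.exp (S ⬝ᵥ (V⁻¹ *ᵥ S) / 2))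

theorem measurable_mixture {α : Type*} {mα : MeasurableSpace α}
    {V : α → Matrix (Fin d) (Fin d) ℝ} {S : α → Fin d → ℝ}
    (hV : ∀ i j, Measurable fun x => V x i j) (hS : ∀ i, Measurable fun x => S x i) :
    Measurable fun x => mixture (V x) (S x) := by
  obtain ⟨W, hW, rfl⟩ : ∃ W : α → Fin d → Fin d → ℝ, Measurable W ∧ V = fun x => Matrix.of (W x) :=
    ⟨fun x i j => V x i j,
      measurable_pi_lambda _ fun i => measurable_pi_lambda _ fun j => hV i j, rfl⟩
  have hof : Continuous fun f : Fin d → Fin d → ℝ => Matrix.of f := continuous_id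
  have hdet : Measurable fun x => (Matrix.of (W x)).det := hof.matrix_det.measurable.comp hW
  have hinv (i j : Fin d) : Measurable fun x => (Matrix.of (W x))⁻¹ i j := by
    have hadj : Measurable fun x => (Matrix.of (W x)).adjugate i j :=
      (hof.matrix_adjugate.matrix_elem i j).measurable.comp hW
    -- Inversion is not continuous at singular matrices; the adjugate formula, with `0⁻¹ = 0`, holds
    -- everywhere.
    have : (fun x => (Matrix.of (W x))⁻¹ i j) =
        fun x => (Matrix.of (W x)).det⁻¹ * (Matrix.of (W x)).adjugate i j := by
      ext x
      simp [Matrix.inv_def]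
    rw [this]
    exact hdet.inv.mul hadj
  have hmul (i : Fin d) : Measurable fun x => ((Matrix.of (W x))⁻¹ *ᵥ S x) i := by
    simp only [Matrix.mulVec, dotProduct]
    exact Finset.measurable_fun_sum _ fun j _ => (hinv i j).mul (hS j)
  have hquad : Measurable fun x => S x ⬝ᵥ ((Matrix.of (W x))⁻¹ *ᵥ S x) :=
    Finset.measurable_fun_sum _ fun i _ => (hS i).mul (hmul i)
  exact (hdet.sqrt.inv.mul (hquad.div_const 2).exp).ennreal_ofReal

theorem measurable_prodMk_matrix {α : Type*} {mα : MeasurableSpace α} {f : α → ENNReal}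
    {V : α → Matrix (Fin d) (Fin d) ℝ} {S a : α → Fin d → ℝ} (hf : Measurable f)
    (hV : ∀ i j, Measurable fun x => V x i j) (hS : ∀ i, Measurable fun x => S x i)
    (ha : ∀ i, Measurable fun x => a x i) :
    Measurable fun x => (f x, (fun i j => V x i j : Fin d → Fin d → ℝ), S x, a x) :=
  hf.prodMk ((measurable_pi_lambda _ fun i => measurable_pi_lambda _ fun j => hV i j).prodMk
    ((measurable_pi_lambda _ hS).prodMk (measurable_pi_lambda _ ha)))

/-- One-step martingale identity. The standard Gaussian density times the updated mixture is the old
mixture times the density of `𝒩(m, 1 + q)`, which integrates to one. -/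
theorem lintegral_mixture_add {V : Matrix (Fin d) (Fin d) ℝ} (hV : V.PosDef) (S a : Fin d → ℝ) :
    ∫⁻ x, mixture (V + Matrix.vecMulVec a a) (S + x • a) ∂(gaussianReal 0 1) = mixture V S := by
  have hq : 0 ≤ a ⬝ᵥ (V⁻¹ *ᵥ a) := dotProduct_mulVec_nonneg_of_posDef hV.inv a
  set m := a ⬝ᵥ (V⁻¹ *ᵥ S) with hm
  set q := a ⬝ᵥ (V⁻¹ *ᵥ a) with hqdef
  have hv : (0 : ℝ) < 1 + q := by positivity
  let v : NNReal := ⟨1 + q, hv.le⟩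
  have hv0 : v ≠ 0 := fun h => hv.ne' (congrArg NNReal.toReal h)
  have hpt (x : ℝ) : gaussianPDF 0 1 x * mixture (V + Matrix.vecMulVec a a) (S + x • a) =
      mixture V S * gaussianPDF m v x := by
    unfold mixture gaussianPDF
    rw [← ENNReal.ofReal_mul (gaussianPDFReal_nonneg _ _ _),
      ← ENNReal.ofReal_mul (by positivity)]
    congr 1
    rw [det_add_vecMulVec hV, dotProduct_inv_add_vecMulVec hV, ← hm, ← hqdef]
    unfold gaussianPDFReal
    have hvv : (v : ℝ) = 1 + q := rfl
    rw [hvv, Real.sqrt_mul hV.det_pos.le, Real.sqrt_mul (by positivity) (1 + q)]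
    have e1 : Real.exp (-(x - 0) ^ 2 / (2 * ((1 : NNReal) : ℝ))) *
        Real.exp ((S ⬝ᵥ (V⁻¹ *ᵥ S) + x ^ 2 - (x - m) ^ 2 / (1 + q)) / 2) =
        Real.exp (S ⬝ᵥ (V⁻¹ *ᵥ S) / 2) * Real.exp (-(x - m) ^ 2 / (2 * (1 + q))) := by
      rw [← Real.exp_add, ← Real.exp_add]
      congr 1
      simp
      field_simp
      ring
    simp only [NNReal.coe_one, mul_one, mul_inv] at e1 ⊢
    linear_combination ((√(2 * Real.pi))⁻¹ * (√V.det)⁻¹ * (√(1 + q))⁻¹) * e1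
  have hmeas : Measurable fun x : ℝ => mixture (V + Matrix.vecMulVec a a) (S + x • a) :=
    measurable_mixture (fun i j => measurable_const) fun i => by
      simp only [Pi.add_apply, Pi.smul_apply, smul_eq_mul]; fun_prop
  rw [gaussianReal_of_var_ne_zero _ one_ne_zero,
    lintegral_withDensity_eq_lintegral_mul _ (measurable_gaussianPDF _ _) hmeas]
  simp only [Pi.mul_apply, hpt]
  rw [lintegral_const_mul _ (measurable_gaussianPDF _ _), lintegral_gaussianPDF_eq_one _ hv0,
    mul_one]

/-- The noise-weighted sum of the first `t` actions. -/
noncomputable def noiseSum (A : ℕ → EuclideanSpace ℝ (Fin d)) (η : ℕ → ℝ) (t : ℕ) : Fin d → ℝ :=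
  ∑ s ∈ Finset.Icc 1 t, η s • (A s).ofLp

theorem gram_succ (A : ℕ → EuclideanSpace ℝ (Fin d)) (t : ℕ) :
    gram A (t + 1) = gram A t + Matrix.vecMulVec (A (t + 1)).ofLp (A (t + 1)).ofLp := by
  unfold gram
  rw [Finset.sum_Icc_succ_top (by omega)]

theorem noiseSum_succ (A : ℕ → EuclideanSpace ℝ (Fin d)) (η : ℕ → ℝ) (t : ℕ) :
    noiseSum A η (t + 1) = noiseSum A η t + η (t + 1) • (A (t + 1)).ofLp := by
  unfold noiseSum
  rw [Finset.sum_Icc_succ_top (by omega)]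

theorem gram_posSemidef (A : ℕ → EuclideanSpace ℝ (Fin d)) (t : ℕ) : (gram A t).PosSemidef :=
  Matrix.posSemidef_sum _ fun _ _ => posSemidef_vecMulVec_self _

section Interaction

variable {Ω : Type*} [mΩ : MeasurableSpace Ω] {P : Measure Ω}
  {ℱ : Filtration ℕ mΩ} {n : ℕ} {𝒜 : Finset (EuclideanSpace ℝ (Fin d))}
  {θ : EuclideanSpace ℝ (Fin d)} {A : ℕ → Ω → EuclideanSpace ℝ (Fin d)} {Y : ℕ → Ω → ℝ}

theorem IsInteraction.measurable_action (h : IsInteraction P ℱ n 𝒜 θ A Y) {k s : ℕ} (hk : k ≤ n)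
    (hs : s ∈ Finset.Icc 1 k) (i : Fin d) : Measurable[ℱ k] fun ω => A s ω i := by
  obtain ⟨h1, h2⟩ := Finset.mem_Icc.1 hs
  obtain ⟨t, rfl⟩ : ∃ t, s = t + 1 := ⟨s - 1, by omega⟩
  have := (h.action_measurable t (by omega)).mono (ℱ.mono (by omega : t ≤ k)) le_rfl
  exact ((EuclideanSpace.proj (𝕜 := ℝ) i).continuous.measurable).comp this

theorem IsInteraction.measurable_noise (h : IsInteraction P ℱ n 𝒜 θ A Y) {k s : ℕ} (hk : k ≤ n)
    (hs : s ∈ Finset.Icc 1 k) : Measurable[ℱ k] (noise θ A Y s) := by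
  obtain ⟨h1, h2⟩ := Finset.mem_Icc.1 hs
  obtain ⟨t, rfl⟩ : ∃ t, s = t + 1 := ⟨s - 1, by omega⟩
  have hA := (h.action_measurable t (by omega)).mono (ℱ.mono (by omega : t ≤ k)) le_rfl
  have hY := (h.reward_measurable t (by omega)).mono (ℱ.mono h2) le_rfl
  exact hY.sub (hA.inner_const)

theorem IsInteraction.measurable_gram (h : IsInteraction P ℱ n 𝒜 θ A Y) {k : ℕ} (hk : k ≤ n)
    (i j : Fin d) : Measurable[ℱ k] fun ω => gram (fun s => A s ω) k i j := by
  simp only [gram, Matrix.sum_apply, Matrix.vecMulVec_apply]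
  exact Finset.measurable_fun_sum _ fun s hs =>
    (h.measurable_action hk hs i).mul (h.measurable_action hk hs j)

theorem IsInteraction.measurable_noiseSum (h : IsInteraction P ℱ n 𝒜 θ A Y) {k : ℕ} (hk : k ≤ n)
    (i : Fin d) :
    Measurable[ℱ k] fun ω => noiseSum (fun s => A s ω) (fun s => noise θ A Y s ω) k i := by
  simp only [noiseSum, Finset.sum_apply, Pi.smul_apply, smul_eq_mul]
  exact Finset.measurable_fun_sum _ fun s hs =>
    (h.measurable_noise hk hs).mul (h.measurable_action hk hs i)

theorem IsInteraction.setLIntegral_mixture_succ [IsProbabilityMeasure P]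
    (h : IsInteraction P ℱ n 𝒜 θ A Y)
    {H : Matrix (Fin d) (Fin d) ℝ} (hH : H.PosDef) {k : ℕ} (hk : k < n) {F : Set Ω}
    (hF : MeasurableSet[ℱ k] F) :
    ∫⁻ ω in F, mixture (H + gram (fun s => A s ω) (k + 1))
        (noiseSum (fun s => A s ω) (fun s => noise θ A Y s ω) (k + 1)) ∂P =
      ∫⁻ ω in F, mixture (H + gram (fun s => A s ω) k)
        (noiseSum (fun s => A s ω) (fun s => noise θ A Y s ω) k) ∂P := by
  -- The indicator of `F` is part of the frozen past, which turns the integral over `F` into one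
  -- over `Ω`.
  let X : Ω → ENNReal × (Fin d → Fin d → ℝ) × (Fin d → ℝ) × (Fin d → ℝ) := fun ω =>
    (F.indicator 1 ω, (fun i j => gram (fun s => A s ω) k i j),
    noiseSum (fun s => A s ω) (fun s => noise θ A Y s ω) k, (A (k + 1) ω).ofLp)
  let g : (ENNReal × (Fin d → Fin d → ℝ) × (Fin d → ℝ) × (Fin d → ℝ)) × ℝ → ENNReal :=
    fun p => p.1.1 *
    mixture (H + (Matrix.of p.1.2.1 + Matrix.vecMulVec p.1.2.2.2 p.1.2.2.2))
      (p.1.2.2.1 + p.2 • p.1.2.2.2)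
  have hX : Measurable[ℱ k] X := by
    refine measurable_prodMk_matrix ((@measurable_one _ _ _ (ℱ k) _).indicator hF)
      (fun i j => h.measurable_gram hk.le i j) (fun i => h.measurable_noiseSum hk.le i) fun i => ?_
    exact ((EuclideanSpace.proj (𝕜 := ℝ) i).continuous.measurable).comp (h.action_measurable k hk)
  have hg : Measurable g := by
    refine Measurable.mul (by fun_prop) (measurable_mixture (fun i j => ?_) fun i => ?_)
    · simp only [Matrix.add_apply, Matrix.of_apply, Matrix.vecMulVec_apply]
      fun_prop
    · simp only [Pi.add_apply, Pi.smul_apply, smul_eq_mul]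
      fun_prop
  have key := lintegral_prodMk_of_indep (ℱ.le k) hX (h.noise_law k hk) (h.noise_indep k hk) hg
  have hFm : MeasurableSet F := ℱ.le k _ hF
  have hind (f : Ω → ENNReal) : ∫⁻ ω in F, f ω ∂P = ∫⁻ ω, F.indicator 1 ω * f ω ∂P := by
    rw [← lintegral_indicator hFm]
    refine lintegral_congr fun ω => ?_
    by_cases hω : ω ∈ F <;> simp [hω]
  rw [hind, hind]
  refine Eq.trans (lintegral_congr fun ω => ?_) (key.trans (lintegral_congr fun ω => ?_))
  · rw [gram_succ, noiseSum_succ]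
    rfl
  · have hV : (H + gram (fun s => A s ω) k).PosDef := hH.add_posSemidef (gram_posSemidef _ _)
    have hm : Measurable fun y : ℝ => mixture
        (H + gram (fun s => A s ω) k + Matrix.vecMulVec (A (k + 1) ω).ofLp (A (k + 1) ω).ofLp)
        (noiseSum (fun s => A s ω) (fun s => noise θ A Y s ω) k + y • (A (k + 1) ω).ofLp) :=
      measurable_mixture (fun i j => measurable_const) fun i => by
        simp only [Pi.add_apply, Pi.smul_apply, smul_eq_mul]; fun_prop
    rw [← lintegral_mixture_add hV _ (A (k + 1) ω).ofLp, ← lintegral_const_mul _ hm]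
    refine lintegral_congr fun y => ?_
    rw [add_assoc]
    rfl

theorem IsInteraction.mul_measure_exists_mixture_le [IsProbabilityMeasure P]
    (h : IsInteraction P ℱ n 𝒜 θ A Y)
    {H : Matrix (Fin d) (Fin d) ℝ} (hH : H.PosDef) (c : ENNReal) :
    c * P {ω | ∃ t ≤ n, c ≤ mixture (H + gram (fun s => A s ω) t)
        (noiseSum (fun s => A s ω) (fun s => noise θ A Y s ω) t)} ≤
      ENNReal.ofReal (√H.det)⁻¹ := by
  refine (mul_measure_exists_le_lintegral (ℱ := ℱ) (n := n)
    (M := fun t ω => mixture (H + gram (fun s => A s ω) t)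
        (noiseSum (fun s => A s ω) (fun s => noise θ A Y s ω) t)) (fun k hk => ?_)
    (fun k hk F hF => (h.setLIntegral_mixture_succ hH hk hF).le) c).trans ?_
  · exact measurable_mixture (fun i j => measurable_const.add (h.measurable_gram hk i j))
      fun i => h.measurable_noiseSum hk i
  -- At time `0` both sums are empty, so the mixture is the constant `(√H.det)⁻¹`.
  · simp [mixture, gram, noiseSum]

end Interaction

end Mixture

/-! ### Dyadic approximation of Gram matrices. -/

section Skeleton

/-- A maximum-weight independent set found greedily: each vector of `T` is in the span of those
chosen vectors which weigh at least as much. -/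
theorem exists_greedy_linearIndepOn {E : Type*} [AddCommGroup E] [Module ℝ E] (T : Finset E)
    (w : E → ℕ) :
    ∃ B ⊆ T, LinearIndepOn ℝ id (B : Set E) ∧
      ∀ a ∈ T, a ∈ Submodule.span ℝ (({b ∈ B | w a ≤ w b} : Finset E) : Set E) := by
  classical
  induction T using Finset.induction_on_min_value w with
  | empty => exact ⟨∅, le_rfl, by simp [linearIndepOn_empty], by simp⟩
  | insert a s has hmin ih =>
    obtain ⟨B, hB, hli, hsp⟩ := ih
    by_cases ha : a ∈ Submodule.span ℝ (B : Set E)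
    · refine ⟨B, hB.trans (Finset.subset_insert _ _), hli, fun x hx => ?_⟩
      rcases Finset.mem_insert.1 hx with rfl | hx
      -- Vectors are added in decreasing order of weight, so every element of `B` weighs at least as
      -- much as the new one.
      · rwa [Finset.filter_true_of_mem fun b hb => hmin b (hB hb)]
      · exact hsp x hx
    · have haB : a ∉ B := fun h => has (hB h)
      refine ⟨insert a B, Finset.insert_subset_insert _ hB, ?_, fun x hx => ?_⟩
      · rw [Finset.coe_insert]
        exact (linearIndepOn_id_insert (by simpa using haB)).2 ⟨hli, ha⟩
      · rcases Finset.mem_insert.1 hx with rfl | hx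
        · exact Submodule.subset_span (by simp)
        · refine Submodule.span_mono ?_ (hsp x hx)
          exact_mod_cast Finset.filter_subset_filter _ (Finset.subset_insert _ _)

variable {d : ℕ}

/-- Cauchy–Schwarz on the coefficients of `a` over `B` gives a constant for each pair `(B, a)`; as
`𝒜` is finite, the sum over all pairs serves uniformly. -/
theorem exists_sq_dotProduct_le (𝒜 : Finset (EuclideanSpace ℝ (Fin d))) :
    ∃ K : ℝ, 0 ≤ K ∧ ∀ B ⊆ 𝒜, ∀ a ∈ 𝒜,
      a ∈ Submodule.span ℝ (B : Set (EuclideanSpace ℝ (Fin d))) →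
      ∀ u : Fin d → ℝ, (u ⬝ᵥ a.ofLp) ^ 2 ≤ K * ∑ b ∈ B, (u ⬝ᵥ b.ofLp) ^ 2 := by
  have h (B : Finset (EuclideanSpace ℝ (Fin d))) (a : EuclideanSpace ℝ (Fin d)) :
      ∃ K : ℝ, 0 ≤ K ∧ (a ∈ Submodule.span ℝ (B : Set (EuclideanSpace ℝ (Fin d))) →
        ∀ u : Fin d → ℝ, (u ⬝ᵥ a.ofLp) ^ 2 ≤ K * ∑ b ∈ B, (u ⬝ᵥ b.ofLp) ^ 2) := by
    by_cases ha : a ∈ Submodule.span ℝ (B : Set (EuclideanSpace ℝ (Fin d)))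
    · obtain ⟨c, -, hc⟩ := Submodule.mem_span_finset.1 ha
      refine ⟨∑ b ∈ B, c b ^ 2, Finset.sum_nonneg fun _ _ => sq_nonneg _, fun _ u => ?_⟩
      have : u ⬝ᵥ a.ofLp = ∑ b ∈ B, c b * (u ⬝ᵥ b.ofLp) := by
        rw [← hc, WithLp.ofLp_sum, dotProduct_sum]
        simp
      rw [this]
      exact Finset.sum_mul_sq_le_sq_mul_sq _ _ _
    · exact ⟨0, le_rfl, fun h => absurd h ha⟩
  choose K hK hK' using h
  refine ⟨∑ B ∈ 𝒜.powerset, ∑ a ∈ 𝒜, K B a,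
    Finset.sum_nonneg fun _ _ => Finset.sum_nonneg fun _ _ => hK _ _, fun B hB a ha hsp u => ?_⟩
  refine (hK' B a hsp u).trans (mul_le_mul_of_nonneg_right ?_
    (Finset.sum_nonneg fun _ _ => sq_nonneg _))
  calc K B a ≤ ∑ a ∈ 𝒜, K B a := Finset.single_le_sum (f := fun a => K B a) (fun _ _ => hK _ _) ha
    _ ≤ _ := Finset.single_le_sum (f := fun B => ∑ a ∈ 𝒜, K B a)
      (fun _ _ => Finset.sum_nonneg fun _ _ => hK _ _) (Finset.mem_powerset.2 hB)

theorem dotProduct_gram_mulVec (A : ℕ → EuclideanSpace ℝ (Fin d)) (t : ℕ) (u : Fin d → ℝ) :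
    u ⬝ᵥ (gram A t *ᵥ u) = ∑ s ∈ Finset.Icc 1 t, (u ⬝ᵥ (A s).ofLp) ^ 2 := by
  rw [gram, Matrix.sum_mulVec, dotProduct_sum]
  exact Finset.sum_congr rfl fun s _ => dotProduct_vecMulVec_mulVec _ _

/-- The Gram matrix of the vectors `(f i).1` taken with multiplicities `2 ^ (f i).2`. -/
noncomputable def dyadicGram (f : Fin d → EuclideanSpace ℝ (Fin d) × ℕ) :
    Matrix (Fin d) (Fin d) ℝ :=
  ∑ i, (2 : ℝ) ^ (f i).2 • Matrix.vecMulVec (f i).1.ofLp (f i).1.ofLp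

theorem dyadicGram_posSemidef (f : Fin d → EuclideanSpace ℝ (Fin d) × ℕ) :
    (dyadicGram f).PosSemidef :=
  Matrix.posSemidef_sum _ fun _ _ => (posSemidef_vecMulVec_self _).smul (by positivity)

theorem dotProduct_dyadicGram_mulVec (f : Fin d → EuclideanSpace ℝ (Fin d) × ℕ) (u : Fin d → ℝ) :
    u ⬝ᵥ (dyadicGram f *ᵥ u) = ∑ i, (2 : ℝ) ^ (f i).2 * (u ⬝ᵥ (f i).1.ofLp) ^ 2 := by
  rw [dyadicGram, Matrix.sum_mulVec, dotProduct_sum]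
  refine Finset.sum_congr rfl fun s _ => ?_
  rw [Matrix.smul_mulVec, dotProduct_smul, dotProduct_vecMulVec_mulVec, smul_eq_mul]

/-- Independence gives `≤`. With fewer than `d` vectors, the map `u ↦ (u ⬝ᵥ b)_b` would have a
nonzero kernel. -/
theorem card_eq_of_linearIndepOn_of_separating {B : Finset (EuclideanSpace ℝ (Fin d))}
    (hB : LinearIndepOn ℝ id (B : Set (EuclideanSpace ℝ (Fin d))))
    (hsep : ∀ u : Fin d → ℝ, (∀ b ∈ B, u ⬝ᵥ b.ofLp = 0) → u = 0) : B.card = d := by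
  apply le_antisymm
  · have := LinearIndependent.fintype_card_le_finrank (R := ℝ) hB
    simpa using this
  · by_contra! hlt
    let φ : (Fin d → ℝ) →ₗ[ℝ] (B → ℝ) :=
      LinearMap.pi fun b => dotProductBilin ℝ ℝ |>.flip (b : EuclideanSpace ℝ (Fin d)).ofLp
    have hker : LinearMap.ker φ ≠ ⊥ := LinearMap.ker_ne_bot_of_finrank_lt (by simpa using hlt)
    obtain ⟨u, hu, hu0⟩ := Submodule.exists_mem_ne_zero_of_ne_bot hker
    refine hu0 (hsep u fun b hb => ?_)
    exact congrFun (LinearMap.mem_ker.1 hu) ⟨b, hb⟩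

/-- Up to a constant depending on `𝒜` only, each non-singular Gram matrix of at most `n` vectors
of `𝒜` is comparable to one of `(#𝒜 * (Nat.log 2 n + 1)) ^ d` dyadic ones. -/
theorem exists_dyadicGram_le_gram (𝒜 : Finset (EuclideanSpace ℝ (Fin d))) :
    ∃ C : ℝ, 0 ≤ C ∧ ∀ (n t : ℕ) (A : ℕ → EuclideanSpace ℝ (Fin d)), t ≤ n →
      (∀ s ∈ Finset.Icc 1 t, A s ∈ 𝒜) → (gram A t).PosDef →
      ∃ f ∈ Fintype.piFinset fun _ : Fin d => 𝒜 ×ˢ Finset.range (Nat.log 2 n + 1),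
        (dyadicGram f).PosDef ∧
        (∀ u, u ⬝ᵥ (dyadicGram f *ᵥ u) ≤ u ⬝ᵥ (gram A t *ᵥ u)) ∧
        ∀ u, u ⬝ᵥ (gram A t *ᵥ u) ≤ C * (u ⬝ᵥ (dyadicGram f *ᵥ u)) := by
  classical
  obtain ⟨K, hK0, hK⟩ := exists_sq_dotProduct_le 𝒜
  -- `#𝒜` comes from summing over arms, `2` from dyadic rounding, `K` from expressing an arm through
  -- chosen arms played at least as often.
  refine ⟨𝒜.card * (2 * K), by positivity, fun n t A htn hA hG => ?_⟩
  let w : EuclideanSpace ℝ (Fin d) → ℕ := fun a => {s ∈ Finset.Icc 1 t | A s = a}.card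
  have hwt (a) : w a ≤ t := (Finset.card_filter_le _ _).trans (by simp)
  have hGw (u : Fin d → ℝ) : u ⬝ᵥ (gram A t *ᵥ u) = ∑ a ∈ 𝒜, (w a : ℝ) * (u ⬝ᵥ a.ofLp) ^ 2 := by
    rw [dotProduct_gram_mulVec, ← Finset.sum_fiberwise_of_maps_to hA]
    refine Finset.sum_congr rfl fun a _ => ?_
    rw [Finset.sum_congr rfl fun s hs => by rw [(Finset.mem_filter.1 hs).2]]
    simp [w]
  -- Unplayed arms are discarded: for them `2 ^ Nat.log 2 0 = 1` would exceed the count `0`.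
  obtain ⟨B, hBT, hli, hsp⟩ := exists_greedy_linearIndepOn {a ∈ 𝒜 | w a ≠ 0} w
  have hB𝒜 : B ⊆ 𝒜 := hBT.trans (Finset.filter_subset _ _)
  have hBw (b) (hb : b ∈ B) : w b ≠ 0 := (Finset.mem_filter.1 (hBT hb)).2
  have hpow_le (b) (hb : b ∈ B) : (2 : ℝ) ^ Nat.log 2 (w b) ≤ w b := by
    exact_mod_cast Nat.pow_log_le_self 2 (hBw b hb)
  have hle_pow (b) : (w b : ℝ) ≤ 2 * 2 ^ Nat.log 2 (w b) := by
    have := (Nat.lt_pow_succ_log_self one_lt_two (w b)).le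
    rw [pow_succ'] at this
    exact_mod_cast this
  have hlow (u : Fin d → ℝ) : ∑ b ∈ B, (2 : ℝ) ^ Nat.log 2 (w b) * (u ⬝ᵥ b.ofLp) ^ 2 ≤
      u ⬝ᵥ (gram A t *ᵥ u) := by
    rw [hGw]
    refine (Finset.sum_le_sum fun b hb => mul_le_mul_of_nonneg_right (hpow_le b hb)
      (sq_nonneg _)).trans (Finset.sum_le_sum_of_subset_of_nonneg hB𝒜 fun _ _ _ => by positivity)
  have hup (u : Fin d → ℝ) : u ⬝ᵥ (gram A t *ᵥ u) ≤
      𝒜.card * (2 * K) * ∑ b ∈ B, (2 : ℝ) ^ Nat.log 2 (w b) * (u ⬝ᵥ b.ofLp) ^ 2 := by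
    rw [hGw, mul_assoc, ← nsmul_eq_mul, ← Finset.sum_const]
    refine Finset.sum_le_sum fun a ha => ?_
    by_cases hwa : w a = 0
    · rw [hwa]
      simp only [Nat.cast_zero, zero_mul]
      have : 0 ≤ ∑ b ∈ B, (2 : ℝ) ^ Nat.log 2 (w b) * (u ⬝ᵥ b.ofLp) ^ 2 :=
        Finset.sum_nonneg fun _ _ => by positivity
      positivity
    have h1 := hK {b ∈ B | w a ≤ w b} ((Finset.filter_subset _ _).trans hB𝒜) a ha
      (hsp a (Finset.mem_filter.2 ⟨ha, hwa⟩)) u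
    calc (w a : ℝ) * (u ⬝ᵥ a.ofLp) ^ 2
        ≤ w a * (K * ∑ b ∈ B with w a ≤ w b, (u ⬝ᵥ b.ofLp) ^ 2) := by gcongr
      _ = K * ∑ b ∈ B with w a ≤ w b, w a * (u ⬝ᵥ b.ofLp) ^ 2 := by
          rw [← Finset.mul_sum]; ring
      _ ≤ K * ∑ b ∈ B with w a ≤ w b, 2 * 2 ^ Nat.log 2 (w b) * (u ⬝ᵥ b.ofLp) ^ 2 := by
          refine mul_le_mul_of_nonneg_left (Finset.sum_le_sum fun b hb => ?_) hK0
          refine mul_le_mul_of_nonneg_right (le_trans ?_ (hle_pow b)) (sq_nonneg _)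
          exact_mod_cast (Finset.mem_filter.1 hb).2
      _ ≤ K * ∑ b ∈ B, 2 * 2 ^ Nat.log 2 (w b) * (u ⬝ᵥ b.ofLp) ^ 2 := by
          refine mul_le_mul_of_nonneg_left (Finset.sum_le_sum_of_subset_of_nonneg
            (Finset.filter_subset _ _) fun _ _ _ => by positivity) hK0
      _ = 2 * K * ∑ b ∈ B, 2 ^ Nat.log 2 (w b) * (u ⬝ᵥ b.ofLp) ^ 2 := by
          simp only [mul_assoc, ← Finset.mul_sum]; ring
  have hpos (u : Fin d → ℝ) (hu : u ≠ 0) : 0 < u ⬝ᵥ (gram A t *ᵥ u) := by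
    simpa using hG.dotProduct_mulVec_pos hu
  have hcard : B.card = d := by
    refine card_eq_of_linearIndepOn_of_separating hli fun u hu => ?_
    by_contra hu0
    refine (hpos u hu0).not_ge ((hup u).trans_eq ?_)
    rw [Finset.sum_eq_zero fun b hb => by rw [hu b hb]; simp, mul_zero]
  let e : Fin d ≃ B := (Finset.equivFinOfCardEq hcard).symm
  let f : Fin d → EuclideanSpace ℝ (Fin d) × ℕ := fun i => (e i, Nat.log 2 (w (e i)))
  have hf (u : Fin d → ℝ) : u ⬝ᵥ (dyadicGram f *ᵥ u) =
      ∑ b ∈ B, (2 : ℝ) ^ Nat.log 2 (w b) * (u ⬝ᵥ b.ofLp) ^ 2 := by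
    rw [dotProduct_dyadicGram_mulVec, ← Finset.sum_coe_sort B]
    exact e.sum_comp fun b : B => (2 : ℝ) ^ Nat.log 2 (w b) *
      (u ⬝ᵥ (b : EuclideanSpace ℝ _).ofLp) ^ 2
  refine ⟨f, ?_, ?_, fun u => (hf u).trans_le (hlow u), fun u => (hup u).trans_eq (by rw [hf])⟩
  · rw [Fintype.mem_piFinset]
    intro i
    rw [Finset.mem_product, Finset.mem_range, Nat.lt_succ_iff]
    exact ⟨hB𝒜 (e i).2, Nat.log_mono_right (b := 2) ((hwt (e i)).trans htn)⟩
  · refine .of_dotProduct_mulVec_pos (dyadicGram_posSemidef f).isHermitian fun u hu => ?_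
    rw [star_trivial]
    have h1 := (hpos u hu).trans_le (hup u)
    rw [← hf] at h1
    exact pos_of_mul_pos_right h1 (by positivity)

end Skeleton

/-! ### From the mixture bound to the confidence width, pathwise. -/

section Deterministic

variable {d : ℕ}

/-- With `V = H / L + G`, the lower comparison gives `V ≤ (1 + 1/L) G`, hence the norm factor; the
upper one gives `V ≤ (1/L + C) H`, hence `det V ≤ (1 + C L) ^ d det (H / L)`. Taking logarithms of
the mixture bound finishes. -/
theorem dotProduct_inv_lt_of_mixture_lt {G H : Matrix (Fin d) (Fin d) ℝ} (hG : G.PosDef)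
    (hH : H.PosDef) {C L r : ℝ} (hC : 0 ≤ C) (hL : 0 < L) (hr : 0 < r)
    (hlow : ∀ u, u ⬝ᵥ (H *ᵥ u) ≤ u ⬝ᵥ (G *ᵥ u))
    (hup : ∀ u, u ⬝ᵥ (G *ᵥ u) ≤ C * (u ⬝ᵥ (H *ᵥ u))) (S : Fin d → ℝ)
    (hS : mixture ((1 / L) • H + G) S < ENNReal.ofReal (r * (√((1 / L) • H).det)⁻¹)) :
    S ⬝ᵥ (G⁻¹ *ᵥ S) < 2 * (1 + 1 / L) * (Real.log r + d / 2 * Real.log (1 + C * L)) := by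
  have hH' : ((1 / L) • H).PosDef := hH.smul (by positivity)
  have hV : ((1 / L) • H + G).PosDef := hH'.add_posSemidef hG.posSemidef
  set V := (1 / L) • H + G with hVdef
  have hVu (u : Fin d → ℝ) : u ⬝ᵥ (V *ᵥ u) = 1 / L * (u ⬝ᵥ (H *ᵥ u)) + u ⬝ᵥ (G *ᵥ u) := by
    rw [hVdef, Matrix.add_mulVec, Matrix.smul_mulVec, dotProduct_add, dotProduct_smul, smul_eq_mul]
  have hL0 : 0 < 1 / L := by positivity
  have h1 : S ⬝ᵥ (G⁻¹ *ᵥ S) ≤ (1 + 1 / L) * (S ⬝ᵥ (V⁻¹ *ᵥ S)) := by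
    refine dotProduct_inv_le_of_le hV hG (by positivity) (fun u => ?_) S
    rw [hVu]
    nlinarith [hlow u]
  have h2 : V.det ≤ (1 / L + C) ^ d * H.det := by
    refine det_le_pow_mul_det hV hH fun u => ?_
    rw [hVu]
    linarith [hup u]
  have h3 : ((1 / L) • H).det = (1 / L) ^ d * H.det := by simp
  have h4 : V.det ≤ (1 + C * L) ^ d * ((1 / L) • H).det := by
    rw [h3, ← mul_assoc, ← mul_pow]
    convert h2 using 3
    field_simp
  set D := ((1 / L) • H).det with hD
  have hDpos : 0 < D := hH'.det_pos
  have hVpos : 0 < V.det := hV.det_pos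
  have hCL : 0 < 1 + C * L := by positivity
  rw [mixture, ENNReal.ofReal_lt_ofReal_iff (by positivity)] at hS
  have h5 := Real.log_lt_log (by positivity) hS
  rw [Real.log_mul (by positivity) (by positivity), Real.log_mul (by positivity) (by positivity),
    Real.log_inv, Real.log_inv, Real.log_exp, Real.log_sqrt hVpos.le, Real.log_sqrt hDpos.le] at h5
  have h6 := Real.log_le_log hVpos h4
  rw [Real.log_mul (by positivity) (by positivity), Real.log_pow] at h6
  have h7 : S ⬝ᵥ (V⁻¹ *ᵥ S) < 2 * (Real.log r + d / 2 * Real.log (1 + C * L)) := by linarith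
  calc _ ≤ _ := h1
    _ < (1 + 1 / L) * (2 * (Real.log r + d / 2 * Real.log (1 + C * L))) := by gcongr
    _ = _ := by ring

theorem inner_lsEstimate_sub {A : ℕ → EuclideanSpace ℝ (Fin d)} {t : ℕ} (hG : IsUnit (gram A t))
    (Y : ℕ → ℝ) (θ x : EuclideanSpace ℝ (Fin d)) :
    inner ℝ x (lsEstimate A Y t) - inner ℝ x θ =
      x.ofLp ⬝ᵥ ((gram A t)⁻¹ *ᵥ noiseSum A (fun s => Y s - inner ℝ (A s) θ) t) := by
  have h : noiseSum A (fun s => Y s - inner ℝ (A s) θ) t =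
      (∑ s ∈ Finset.Icc 1 t, Y s • A s).ofLp - gram A t *ᵥ θ.ofLp := by
    rw [noiseSum, gram, Matrix.sum_mulVec, WithLp.ofLp_sum, ← Finset.sum_sub_distrib]
    refine Finset.sum_congr rfl fun s _ => ?_
    rw [sub_smul, Matrix.vecMulVec_mulVec]
    ext i
    simp [EuclideanSpace.inner_eq_star_dotProduct, dotProduct_comm]
  rw [h, Matrix.mulVec_sub, inv_mulVec_mulVec hG, dotProduct_sub, lsEstimate]
  simp [EuclideanSpace.inner_eq_star_dotProduct, dotProduct_comm]

theorem le_dotProduct_inv_of_sqrt_le {A : ℕ → EuclideanSpace ℝ (Fin d)} {t : ℕ}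
    (hG : (gram A t).PosDef) (Y : ℕ → ℝ) (θ : EuclideanSpace ℝ (Fin d))
    {x : EuclideanSpace ℝ (Fin d)} (hx : x ≠ 0) {w : ℝ}
    (h : √(sqNorm (gram A t)⁻¹ x * w) ≤ |inner ℝ x (lsEstimate A Y t) - inner ℝ x θ|) :
    w ≤ noiseSum A (fun s => Y s - inner ℝ (A s) θ) t ⬝ᵥ
      ((gram A t)⁻¹ *ᵥ noiseSum A (fun s => Y s - inner ℝ (A s) θ) t) := by
  rw [inner_lsEstimate_sub hG.isUnit, Real.sqrt_le_iff, sq_abs] at h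
  have hx' : x.ofLp ≠ 0 := fun h0 => hx (by ext i; simp [h0])
  have hpos : 0 < x.ofLp ⬝ᵥ ((gram A t)⁻¹ *ᵥ x.ofLp) := by
    simpa using hG.inv.dotProduct_mulVec_pos hx'
  exact le_of_mul_le_mul_left (h.2.trans (sq_dotProduct_inv_le hG _ _)) hpos

theorem gram_posDef_of_le {A : ℕ → EuclideanSpace ℝ (Fin d)} {t₀ t : ℕ} (ht : t₀ ≤ t)
    (h : IsUnit (gram A t₀)) : (gram A t).PosDef := by
  induction t, ht using Nat.le_induction with
  | base => exact (gram_posSemidef A t₀).posDef_iff_isUnit.2 h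
  | succ k _ ih => rw [gram_succ]; exact ih.add_posSemidef (posSemidef_vecMulVec_self _)

end Deterministic

/-! ### Size of the confidence width. -/

section Width

theorem isEquivalent_width (c : ℝ) (d : ℕ) : Asymptotics.IsEquivalent Filter.atTop
    (fun n : ℕ => width c d n (1 / (n : ℝ))) (fun n : ℕ => 2 * Real.log n) := by
  have hlog : Filter.Tendsto (fun n : ℕ => Real.log n) Filter.atTop Filter.atTop :=
    Real.tendsto_log_atTop.comp tendsto_natCast_atTop_atTop
  have hL : (fun L : ℝ => 2 + c * d * (Real.log d + Real.log L)) =o[Filter.atTop]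
      fun L : ℝ => 2 * L := by
    have h1 (a : ℝ) : (fun _ : ℝ => a) =o[Filter.atTop] fun L : ℝ => L :=
      Asymptotics.isLittleO_const_id_atTop a
    have h2 : (fun L : ℝ => c * d * (Real.log d + Real.log L)) =o[Filter.atTop] fun L : ℝ => L :=
      ((h1 _).add Real.isLittleO_log_id_atTop).const_mul_left _
    exact ((h1 2).add h2).const_mul_right two_ne_zero
  refine (hL.comp_tendsto hlog).congr' ?_ Filter.EventuallyEq.rfl
  filter_upwards [hlog.eventually_gt_atTop 0] with n hn
  simp only [Function.comp_apply, Pi.sub_apply, width]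
  rcases Nat.eq_zero_or_pos d with rfl | hd
  · simp
    field_simp
    ring
  rw [Real.log_mul (by positivity) hn.ne']
  simp
  field_simp
  ring

/-- The count contributes `3 d log L`, the determinant `(3/2) d log L`, and the prefactor is at most
`4`: this is where `18 = 4 (3 + 3/2)` originates. -/
theorem log_card_add_log_det_le_width {d n k : ℕ} (hd : 0 < d) {C δ : ℝ} (hC : 0 ≤ C) (hδ : 0 < δ)
    (hk0 : 0 < k) (h3 : 3 ≤ Real.log n) (hk : (k : ℝ) ≤ Real.log n) (hCL : C ≤ Real.log n) :
    2 * (1 + 1 / Real.log n) * (Real.log (((k * (Nat.log 2 n + 1)) ^ d : ℕ) / δ) +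
      d / 2 * Real.log (1 + C * Real.log n)) ≤ width 18 d n δ := by
  set L := Real.log n with hL
  have hLpos : 0 < L := by linarith
  have hlogL : 0 ≤ Real.log L := Real.log_nonneg (by linarith)
  have hn2 : (Nat.log 2 n : ℝ) ≤ 2 * L := by
    have h1 : (Nat.log 2 n : ℝ) ≤ Real.logb 2 n := by exact_mod_cast Real.natLog_le_logb n 2
    refine h1.trans ?_
    rw [Real.logb, div_le_iff₀ (Real.log_pos one_lt_two)]
    -- Only `log 2 ≥ 1/2` matters.
    nlinarith [Real.log_two_gt_d9]
  have hN : Real.log (((k * (Nat.log 2 n + 1)) ^ d : ℕ) : ℝ) ≤ d * (3 * Real.log L) := by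
    push_cast
    rw [Real.log_pow]
    gcongr
    rw [← Nat.cast_ofNat (n := 3), ← Real.log_pow]
    refine Real.log_le_log (by positivity) ?_
    calc (k : ℝ) * (Nat.log 2 n + 1) ≤ L * L ^ 2 := by
          gcongr
          nlinarith
      _ = L ^ 3 := by ring
  have hC' : Real.log (1 + C * L) ≤ 3 * Real.log L := by
    rw [← Nat.cast_ofNat (n := 3), ← Real.log_pow]
    refine Real.log_le_log (by positivity) ?_
    have : C * L ≤ L * L := by gcongr
    have : 3 * (L * L) ≤ L * (L * L) := by gcongr
    nlinarith
  have hdL : Real.log L ≤ Real.log (d * L) := by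
    refine Real.log_le_log hLpos (le_mul_of_one_le_left hLpos.le ?_)
    exact_mod_cast hd
  have hNpos : (((k * (Nat.log 2 n + 1)) ^ d : ℕ) : ℝ) ≠ 0 := by positivity
  have hN0 : 0 ≤ Real.log (((k * (Nat.log 2 n + 1)) ^ d : ℕ) : ℝ) := Real.log_natCast_nonneg _
  have hC0 : 0 ≤ Real.log (1 + C * L) := Real.log_nonneg (by nlinarith)
  have h1L : 1 + 1 / L ≤ 2 := by
    have : 1 / L ≤ 1 := by rw [div_le_one hLpos]; linarith
    linarith
  rw [width, ← hL, Real.log_div hNpos hδ.ne', one_div δ, Real.log_inv]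
  calc _ = 2 * (1 + 1 / L) * -Real.log δ + 2 * (1 + 1 / L) *
        (Real.log (((k * (Nat.log 2 n + 1)) ^ d : ℕ) : ℝ) + d / 2 * Real.log (1 + C * L)) := by ring
    _ ≤ 2 * (1 + 1 / L) * -Real.log δ + 2 * 2 *
        (d * (3 * Real.log L) + d / 2 * (3 * Real.log L)) := by gcongr
    _ = 2 * (1 + 1 / L) * -Real.log δ + 18 * d * Real.log L := by ring
    _ ≤ _ := by gcongr

end Width

/-! ### Union bound over the dyadic matrices. -/

section Confidence

variable {d : ℕ} {Ω : Type*} [mΩ : MeasurableSpace Ω] {P : Measure Ω} [IsProbabilityMeasure P]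
  {ℱ : Filtration ℕ mΩ} {n : ℕ} {𝒜 : Finset (EuclideanSpace ℝ (Fin d))}
  {θ : EuclideanSpace ℝ (Fin d)} {A : ℕ → Ω → EuclideanSpace ℝ (Fin d)} {Y : ℕ → Ω → ℝ}

theorem IsInteraction.measure_exists_mixture_le_div (h : IsInteraction P ℱ n 𝒜 θ A Y)
    {H : Matrix (Fin d) (Fin d) ℝ} (hH : H.PosDef) {N δ : ℝ} (hN : 0 < N) (hδ : 0 < δ) :
    P {ω | ∃ t ≤ n, ENNReal.ofReal (N / δ * (√H.det)⁻¹) ≤ mixture (H + gram (fun s => A s ω) t)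
        (noiseSum (fun s => A s ω) (fun s => noise θ A Y s ω) t)} ≤ ENNReal.ofReal (δ / N) := by
  have hD : 0 < (√H.det)⁻¹ := by have := hH.det_pos; positivity
  have h1 := h.mul_measure_exists_mixture_le hH (ENNReal.ofReal (N / δ * (√H.det)⁻¹))
  have hpos : 0 < N / δ * (√H.det)⁻¹ := by positivity
  rw [mul_comm, ← ENNReal.le_div_iff_mul_le (Or.inl (by simpa using hpos))
    (Or.inl ENNReal.ofReal_ne_top), ← ENNReal.ofReal_div_of_pos hpos] at h1
  refine h1.trans_eq ?_
  congr 1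
  rw [mul_comm, ← div_div, div_self hD.ne', one_div_div]

theorem IsInteraction.measureReal_exists_sqrt_le (h : IsInteraction P ℱ n 𝒜 θ A Y) {C δ w L : ℝ}
    (hC : 0 ≤ C) (hδ : 0 < δ) (hL : 0 < L) (h𝒜 : 𝒜.Nonempty)
    (hdy : ∀ (t : ℕ) (A : ℕ → EuclideanSpace ℝ (Fin d)), t ≤ n →
      (∀ s ∈ Finset.Icc 1 t, A s ∈ 𝒜) → (gram A t).PosDef →
      ∃ f ∈ Fintype.piFinset fun _ : Fin d => 𝒜 ×ˢ Finset.range (Nat.log 2 n + 1),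
        (dyadicGram f).PosDef ∧
        (∀ u, u ⬝ᵥ (dyadicGram f *ᵥ u) ≤ u ⬝ᵥ (gram A t *ᵥ u)) ∧
        ∀ u, u ⬝ᵥ (gram A t *ᵥ u) ≤ C * (u ⬝ᵥ (dyadicGram f *ᵥ u)))
    (hw : 2 * (1 + 1 / L) * (Real.log (((𝒜.card * (Nat.log 2 n + 1)) ^ d : ℕ) / δ) +
      d / 2 * Real.log (1 + C * L)) ≤ w) {t₀ : ℕ}
    (ht₀ : ∀ᵐ ω ∂P, IsUnit (gram (fun s => A s ω) t₀)) :
    P.real {ω | ∃ t : ℕ, t₀ ≤ t ∧ t ≤ n ∧ ∃ x ∈ 𝒜, x ≠ 0 ∧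
      √(sqNorm (gram (fun s => A s ω) t)⁻¹ x * w) ≤
        |inner ℝ x (lsEstimate (fun s => A s ω) (fun s => Y s ω) t) - inner ℝ x θ|} ≤ δ := by
  classical
  set N : ℕ := (𝒜.card * (Nat.log 2 n + 1)) ^ d with hNdef
  have hNpos : 0 < N := by have := h𝒜.card_pos; positivity
  have hNpos' : (0 : ℝ) < N := by exact_mod_cast hNpos
  let I := (Fintype.piFinset fun _ : Fin d => 𝒜 ×ˢ Finset.range (Nat.log 2 n + 1)).filter
    fun f => (dyadicGram f).PosDef
  have hI : I.card ≤ N := (Finset.card_filter_le _ _).trans (by simp [hNdef])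
  let bad : (Fin d → EuclideanSpace ℝ (Fin d) × ℕ) → Set Ω := fun f =>
    {ω | ∃ t ≤ n, ENNReal.ofReal (N / δ * (√((1 / L) • dyadicGram f).det)⁻¹) ≤
      mixture ((1 / L) • dyadicGram f + gram (fun s => A s ω) t)
        (noiseSum (fun s => A s ω) (fun s => noise θ A Y s ω) t)}
  have hbad (f) (hf : f ∈ I) : P (bad f) ≤ ENNReal.ofReal (δ / N) :=
    h.measure_exists_mixture_le_div ((Finset.mem_filter.1 hf).2.smul (by positivity)) hNpos' hδ
  have hunion : P (⋃ f ∈ I, bad f) ≤ ENNReal.ofReal δ := by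
    calc P (⋃ f ∈ I, bad f) ≤ ∑ f ∈ I, P (bad f) := measure_biUnion_finset_le _ _
      _ ≤ ∑ f ∈ I, ENNReal.ofReal (δ / N) := Finset.sum_le_sum hbad
      _ = I.card * ENNReal.ofReal (δ / N) := by simp
      _ ≤ N * ENNReal.ofReal (δ / N) := by gcongr
      _ = ENNReal.ofReal δ := by
          rw [← ENNReal.ofReal_natCast, ← ENNReal.ofReal_mul hNpos'.le]
          congr 1
          field_simp
  -- Almost surely the failure event lies in the union of the bad sets: outside it, the mixture
  -- bound for the `f` approximating `G_t` contradicts the failure at time `t`.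
  refine ENNReal.toReal_le_of_le_ofReal hδ.le (le_trans (measure_mono_ae ?_) hunion)
  filter_upwards [ht₀] with ω hω
  rintro ⟨t, ht₀t, htn, x, -, hx0, hx⟩
  by_contra hnot
  have hG : (gram (fun s => A s ω) t).PosDef := gram_posDef_of_le ht₀t hω
  obtain ⟨f, hfmem, hfpos, hlow, hup⟩ := hdy t (fun s => A s ω) htn (fun s hs => by
    obtain ⟨h1, h2⟩ := Finset.mem_Icc.1 hs
    obtain ⟨r, rfl⟩ : ∃ r, s = r + 1 := ⟨s - 1, by omega⟩
    exact h.action_mem r (by omega) ω) hG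
  have hlt := dotProduct_inv_lt_of_mixture_lt hG hfpos hC hL (div_pos hNpos' hδ) hlow hup
    (noiseSum (fun s => A s ω) (fun s => noise θ A Y s ω) t) (by
      by_contra! hge
      exact hnot (Set.mem_biUnion (Finset.mem_filter.2 ⟨hfmem, hfpos⟩) ⟨t, htn, hge⟩))
  exact ((le_dotProduct_inv_of_sqrt_le hG (fun s => Y s ω) θ hx0 hx).trans_lt hlt).not_ge hw

end Confidence

end LinearBandit

theorem theorem3 :
    ∃ c : ℝ, 0 < c ∧
      (∀ d : ℕ, Asymptotics.IsEquivalent Filter.atTop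
        (fun n : ℕ => LinearBandit.width c d n (1 / (n : ℝ)))
        (fun n : ℕ => 2 * Real.log n)) ∧
      ∀ (d : ℕ) (𝒜 : Finset (EuclideanSpace ℝ (Fin d))),
        Submodule.span ℝ (𝒜 : Set (EuclideanSpace ℝ (Fin d))) = ⊤ →
        (∀ x ∈ 𝒜, ‖x‖ ≤ 1) →
        ∃ n₀ : ℕ, ∀ n : ℕ, n₀ ≤ n → ∀ δ : ℝ, 1 / (n : ℝ) ≤ δ → δ < 1 →
          ∀ (θ : EuclideanSpace ℝ (Fin d))
            (Ω : Type*) [mΩ : MeasurableSpace Ω] (P : MeasureTheory.Measure Ω)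
            [MeasureTheory.IsProbabilityMeasure P] (ℱ : MeasureTheory.Filtration ℕ mΩ)
            (A : ℕ → Ω → EuclideanSpace ℝ (Fin d)) (Y : ℕ → Ω → ℝ),
            LinearBandit.IsInteraction P ℱ n 𝒜 θ A Y →
            ∀ t₀ : ℕ,
              (∀ᵐ ω ∂P, IsUnit (LinearBandit.gram (fun s => A s ω) t₀)) →
              P.real {ω | ∃ t : ℕ, t₀ ≤ t ∧ t ≤ n ∧ ∃ x ∈ 𝒜, x ≠ 0 ∧
                √(LinearBandit.sqNorm (LinearBandit.gram (fun s => A s ω) t)⁻¹ x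
                    * LinearBandit.width c d n δ) ≤
                  |inner ℝ x (LinearBandit.lsEstimate (fun s => A s ω) (fun s => Y s ω) t)
                    - inner ℝ x θ|} ≤ δ := by
  refine ⟨18, by norm_num, LinearBandit.isEquivalent_width 18, fun d 𝒜 hspan _ => ?_⟩
  obtain ⟨C, hC, hdy⟩ := LinearBandit.exists_dyadicGram_le_gram 𝒜
  have hlog : Filter.Tendsto (fun n : ℕ => Real.log n) Filter.atTop Filter.atTop :=
    Real.tendsto_log_atTop.comp tendsto_natCast_atTop_atTop
  obtain ⟨n₀, hn₀⟩ := Filter.eventually_atTop.1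
    ((hlog.eventually_ge_atTop 3).and ((hlog.eventually_ge_atTop (𝒜.card : ℝ)).and
      ((hlog.eventually_ge_atTop C).and (Filter.eventually_gt_atTop 0))))
  refine ⟨n₀, fun n hn δ hδn _ θ Ω mΩ P _ ℱ A Y h t₀ ht₀ => ?_⟩
  obtain ⟨h3, hk, hCL, hn0⟩ := hn₀ n hn
  have hδ : 0 < δ := lt_of_lt_of_le (by positivity) hδn
  -- In dimension `0` there is no nonzero `x`, so the event is empty; `log (d * log n)` is only
  -- useful for `d ≥ 1`.
  rcases Nat.eq_zero_or_pos d with rfl | hd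
  · refine (congrArg P.real (Set.eq_empty_of_forall_notMem ?_)).trans_le (by simpa using hδ.le)
    rintro ω ⟨t, -, -, x, -, hx, -⟩
    exact hx (Subsingleton.elim _ _)
  have h𝒜 : 𝒜.Nonempty := by
    rw [Finset.nonempty_iff_ne_empty]
    rintro rfl
    have : Nonempty (Fin d) := ⟨⟨0, hd⟩⟩
    simp at hspan
  exact h.measureReal_exists_sqrt_le hC hδ (by linarith) h𝒜 (hdy n)
    (LinearBandit.log_card_add_log_det_le_width hd hC hδ h𝒜.card_pos h3 hk hCL) ht₀
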